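/- Consider a network of $n$ linear discrete-time control systems $\Sigma_i:\ x^{(i)}_{k+1}=A_ix^{(i)}_k+B_iu^{(i)}_k$, $i=1,\dots,n$, with $A_i\in\mathbb R^{d_i\times d_i}$, $B_i\in\mathbb R^{d_i\times m_i}$ and control value sets $U_i\subset\mathbb R^{m_i}$ such that each $U_i$ has at least two elements and is contained in the closure of its interior (for instance $U_i=\mathbb R^{m_i}$, $m_i\ge 1$). Let $\Sigma$ be the product system on $X=\prod_i\mathbb R^{d_i}$ with controls in $U=\prod_iU_i$, right-hand side $f(x,u)=(A_ix_i+B_iu_i)_i$, and let $\varphi(k,x,\omega)$ be its state at time $k$ when started at $x$ with control sequence $\omega\in U^{\mathbb Z_+}=\prod_iU_i^{\mathbb Z_+}$. Assume that every pair $(A_i,B_i)$ is controllable, i.e. with unconstrained controls in $\mathbb R^{m_i}$ every state can be steered to every state in finite time. Let $Q\subset X$ be compact with nonempty interior, and assume that there is a compact set $K\subset\operatorname{int}Q$ such that for every $x\in Q$ there is $u\in U$ with $f(x,u)\in\operatorname{int}K$. For an integer $\tau>0$, a set $\mathcal S\subset U^{\mathbb Z_+}$ is called $(\tau,Q)$-spanning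 if for every $x\in Q$ there is $\omega\in\mathcal S$ with $\varphi(k,x,\omega)\in\operatorname{int}Q$ for $k=1,\dots,\tau$. Put $$H_\tau(Q)=\Bigl\{\tfrac1\tau(\log_2\#\mathcal S_1,\dots,\log_2\#\mathcal S_n):\ \mathcal S_i\subset U_i^{\mathbb Z_+}\text{ finite},\ \mathcal S_1\times\cdots\times\mathcal S_n\ (\tau,Q)\text{-spanning}\Bigr\},$$ and let the network entropy set be $H(Q)=\bigcap_{\tau>0}\operatorname{cl}\bigcup_{t\ge\tau}H_t(Q)\subset\mathbb R^n$. Then $$H(Q)=\prod_{i=1}^n\Bigl[\sum_{\lambda\in\sigma(A_i)}\max\{0,n_\lambda\log_2|\lambda|\},\ \infty\Bigr),$$ where $\sigma(A_i)$ is the set of complex eigenvalues of $A_i$, $n_\lambda$ is the algebraic multiplicity of $\lambda$, and $\log_2 0=-\infty$. -/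

import Mathlib

/-- A discrete-time control system `x_{k+1} = f (x_k, u_k)` with state space `X` and control value
set `U`, the right-hand side being continuous in the state for each fixed control value. -/
structure ControlSystem (X U : Type*) [TopologicalSpace X] where
  /-- The right-hand side. -/
  f : X → U → X
  /-- Continuity in the state. -/
  continuous_f : ∀ u, Continuous fun x => f x u

namespace ControlSystem

section Single

variable {X U : Type*} [TopologicalSpace X]

/-- The transition map `φ(k, x, ω)`. -/
def transition (C : ControlSystem X U) (ω : ℕ → U) : ℕ → X → X
  | 0, x => x
  | k + 1, x => C.f (C.transition ω k x) (ω k)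

/-- `S` is `(τ, Q)`-spanning: every `x ∈ Q` has a control sequence `ω ∈ S` with
`φ(k, x, ω) ∈ int Q` for `k = 1, …, τ`. -/
def IsSpanning (C : ControlSystem X U) (τ : ℕ) (Q : Set X) (S : Set (ℕ → U)) : Prop :=
  ∀ x ∈ Q, ∃ ω ∈ S, ∀ k : ℕ, 1 ≤ k → k ≤ τ → C.transition ω k x ∈ interior Q

/-- The strong invariance condition on `Q`: there is a compact set `K ⊆ int Q` such that every
point of `Q` can be steered into `int K` in one step of time. -/
def StronglyInvariant (C : ControlSystem X U) (Q : Set X) : Prop :=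
  ∃ K : Set X, IsCompact K ∧ K ⊆ interior Q ∧ ∀ x ∈ Q, ∃ u : U, C.f x u ∈ interior K

end Single

section Network

variable {ι : Type*} {X U : ι → Type*} [∀ i, TopologicalSpace (X i)]

/-- The overall system of a network: the direct product of its subsystems. -/
def network (C : ∀ i, ControlSystem (X i) (U i)) : ControlSystem (∀ i, X i) (∀ i, U i) where
  f x u := fun i => (C i).f (x i) (u i)
  continuous_f u :=
    continuous_pi fun i => ((C i).continuous_f (u i)).comp (continuous_apply i)

/-- The product of finite sets of control sequences of the subsystems, as a set of control
sequences of the overall system. -/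
def controlProduct (S : ∀ i, Finset (ℕ → U i)) : Set (ℕ → ∀ i, U i) :=
  {ω | ∀ i, (fun k => ω k i) ∈ S i}

/-- The set `H_τ(Q)` of finite-time entropy vectors: all vectors `(1/τ) (log₂ #S_i)_i` with
finite sets `S_i` whose product is `(τ, Q)`-spanning. -/
noncomputable def finiteTimeEntropySet (C : ∀ i, ControlSystem (X i) (U i)) (Q : Set (∀ i, X i))
    (τ : ℕ) : Set (ι → ℝ) :=
  {ξ | ∃ S : ∀ i, Finset (ℕ → U i),
    (network C).IsSpanning τ Q (controlProduct S) ∧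
      ∀ i, ξ i = (1 / (τ : ℝ)) * Real.logb 2 ((S i).card : ℝ)}

/-- The network entropy set `H(Q) = ⋂_{τ > 0} cl ⋃_{t ≥ τ} H_t(Q)`. -/
noncomputable def networkEntropySet (C : ∀ i, ControlSystem (X i) (U i)) (Q : Set (∀ i, X i)) :
    Set (ι → ℝ) :=
  ⋂ (τ : ℕ) (_ : 0 < τ), closure (⋃ (t : ℕ) (_ : τ ≤ t), finiteTimeEntropySet C Q t)

end Network

/-- The linear system `x_{k+1} = A x_k + B u_k` on `ℝ^d` with control values in `U ⊆ ℝ^m`. -/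
def linear {d m : ℕ} (A : Matrix (Fin d) (Fin d) ℝ) (B : Matrix (Fin d) (Fin m) ℝ)
    (U : Set (Fin m → ℝ)) : ControlSystem (Fin d → ℝ) U where
  f x u := A.mulVec x + B.mulVec (u : Fin m → ℝ)
  continuous_f _ := (continuous_const.matrix_mulVec continuous_id).add continuous_const

end ControlSystem

/-- The pair `(A, B)` is controllable: with unconstrained controls, `x_{k+1} = A x_k + B u_k` can be
steered from every state to every state in finite time. -/
def IsControllablePair {d m : ℕ} (A : Matrix (Fin d) (Fin d) ℝ) (B : Matrix (Fin d) (Fin m) ℝ) :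
    Prop :=
  ∀ x y : Fin d → ℝ, ∃ (T : ℕ) (ω : ℕ → (Set.univ : Set (Fin m → ℝ))),
    (ControlSystem.linear A B Set.univ).transition ω T x = y

/-- `∑_{λ ∈ σ(A)} max {0, n_λ log₂ |λ|}`, summed over the distinct complex eigenvalues `λ` of `A`,
with algebraic multiplicities `n_λ`. The term of `λ = 0` is `0` (here `Real.logb 2 0 = 0`), in
agreement with the convention `log 0 = -∞`. -/
noncomputable def unstableLogSum {d : ℕ} (A : Matrix (Fin d) (Fin d) ℝ) : ℝ :=
  ∑ l ∈ (A.map (algebraMap ℝ ℂ)).charpoly.roots.toFinset,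
    max 0 (((A.map (algebraMap ℝ ℂ)).charpoly.rootMultiplicity l : ℝ) * Real.logb 2 ‖l‖)

/-! Let `Au` be the block of `A i` carrying the eigenvalues of modulus `> 1`. The i-th bound
`unstableLogSum (A i)` is `log₂ |det Au|`, the exponential growth rate of volume along the unstable
directions.

Lower bound (`mul_unstableLogSum_le_logb_card`): project `Q` to the unstable coordinates of
subsystem `i`. The image `W` has finite positive volume. For one control sequence, the points of `W`
that lie in `W` again at time `t` after an affine map with linear part `Au ^ t` fill at most `|det
Au|⁻ᵗ vol W`, so covering `W` takes at least `|det Au|ᵗ` sequences.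

Upper bound (`exists_isSpanning_controlProduct`): strong invariance gives nominal trajectories in
`Q`, inside a compact subset of `int Q` from time 1 on, with controls uniformly inside `U i`.
Finitely many starting points `c`, independent of `t`, approximate all of `Q`. The deviation from
the nominal trajectory obeys the linear subsystems separately, and
`IsControllablePair.exists_small_controls` keeps each deviation small with about `2 ^ (t h)` small
corrections. These come from cutting a neighborhood of the origin into cells that `A ^ T` expands to
its full size, and steering the centre of each cell to the origin.

Larger vectors are reached by padding the sets with superfluous control sequences. -/

/-! ### Splitting off the unstable eigenvalues -/

section Spectral

open Polynomial

/-- A complex polynomial fixed by complex conjugation has real coefficients. -/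
lemma Polynomial.exists_map_ofReal_of_map_conj_eq (p : ℂ[X])
    (hp : p.map (starRingEnd ℂ) = p) : ∃ q : ℝ[X], q.map (algebraMap ℝ ℂ) = p := by
  refine (Polynomial.mem_lifts p).1 ((Polynomial.lifts_iff_coeff_lifts p).2 fun k => ?_)
  have h : starRingEnd ℂ (p.coeff k) = p.coeff k := by
    conv_rhs => rw [← hp]
    rw [coeff_map]
  obtain ⟨r, hr⟩ := Complex.conj_eq_iff_real.1 h
  exact ⟨r, by simpa using hr.symm⟩

/-- The product of the factors `X - l` of a real polynomial, over its complex roots `l` in a set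
which is invariant under conjugation, is real. -/
lemma Polynomial.exists_map_ofReal_eq_prod_filter (p : ℝ[X]) (s : ℂ → Prop) [DecidablePred s]
    (hs : ∀ z, s (starRingEnd ℂ z) ↔ s z) :
    ∃ q : ℝ[X], q.map (algebraMap ℝ ℂ) =
      (((p.map (algebraMap ℝ ℂ)).roots.filter s).map fun l => X - C l).prod := by
  apply Polynomial.exists_map_ofReal_of_map_conj_eq
  set P := p.map (algebraMap ℝ ℂ) with hP
  have hPP : P.map (starRingEnd ℂ) = P := by
    rw [hP, Polynomial.map_map]
    congr 1
    ext x
    simp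
  have hroots : P.roots.map (starRingEnd ℂ) = P.roots := by
    conv_rhs => rw [← hPP]
    exact ((IsAlgClosed.splits P).roots_map _).symm
  rw [Polynomial.map_multiset_prod, Multiset.map_map]
  have : (P.roots.filter s).map (starRingEnd ℂ) = P.roots.filter s := by
    conv_rhs => rw [← hroots, Multiset.filter_map]
    congr 1
    exact Multiset.filter_congr fun z _ => (hs z).symm
  conv_rhs => rw [← this, Multiset.map_map]
  congr 1
  exact Multiset.map_congr rfl fun z _ => by simp

/-- Complex roots of the characteristic polynomial of a real matrix are roots of every real
polynomial annihilating the matrix. -/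
lemma Matrix.eval_eq_zero_of_aeval_eq_zero {k : ℕ} (M : Matrix (Fin k) (Fin k) ℝ) (p : ℝ[X])
    (hp : aeval M p = 0) {l : ℂ} (hl : l ∈ (M.map (algebraMap ℝ ℂ)).charpoly.roots) :
    (p.map (algebraMap ℝ ℂ)).eval l = 0 := by
  have h1 : l ∈ spectrum ℂ (M.map (algebraMap ℝ ℂ)) :=
    Matrix.mem_spectrum_iff_isRoot_charpoly.2 (isRoot_of_mem_roots hl)
  -- Spectral mapping puts `p(l)` into the spectrum of `p(M) = 0`; a nonzero `p(l)` would be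
  -- invertible there.
  have h2 := spectrum.subset_polynomial_aeval (M.map (algebraMap ℝ ℂ)) (p.map (algebraMap ℝ ℂ))
    ⟨l, h1, rfl⟩
  have h3 : aeval (M.map (algebraMap ℝ ℂ)) (p.map (algebraMap ℝ ℂ)) = 0 := by
    have : aeval (M.map (algebraMap ℝ ℂ)) p = (Algebra.ofId ℝ ℂ).mapMatrix (aeval M p) := by
      rw [← Polynomial.aeval_algHom_apply]
      rfl
    rw [aeval_map_algebraMap, this, hp, map_zero]
  rw [h3] at h2
  by_contra h0
  refine h2 ?_
  rw [spectrum.mem_resolventSet_iff, sub_zero]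
  exact (IsUnit.mk0 _ h0).map (algebraMap ℂ _)

/-- A real square matrix is conjugate to a block diagonal matrix whose first block has only
eigenvalues of modulus `> 1` and whose second block has only eigenvalues of modulus `≤ 1`. -/
lemma Matrix.exists_unstable_stable_splitting {d : ℕ} (A : Matrix (Fin d) (Fin d) ℝ) :
    ∃ (p q : ℕ) (Au : Matrix (Fin p) (Fin p) ℝ) (As : Matrix (Fin q) (Fin q) ℝ)
      (P : (Fin d → ℝ) ≃ₗ[ℝ] (Fin p → ℝ) × (Fin q → ℝ)),
      (∀ x, P (A.mulVec x) = (Au.mulVec (P x).1, As.mulVec (P x).2)) ∧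
      A.charpoly = Au.charpoly * As.charpoly ∧
      (∀ l ∈ (Au.map (algebraMap ℝ ℂ)).charpoly.roots, 1 < ‖l‖) ∧
      (∀ l ∈ (As.map (algebraMap ℝ ℂ)).charpoly.roots, ‖l‖ ≤ 1) := by
  classical
  set f := Matrix.toLin' A with hf
  have hfc : f.charpoly = A.charpoly := by rw [hf, Matrix.charpoly_toLin']
  -- Conjugation preserves the modulus, so both factors are real. Having no common root they are
  -- coprime, and Cayley–Hamilton makes their kernels complementary.
  obtain ⟨pu, hpu⟩ := Polynomial.exists_map_ofReal_eq_prod_filter A.charpoly (fun z => 1 < ‖z‖)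
    (fun z => by simp)
  obtain ⟨ps, hps⟩ := Polynomial.exists_map_ofReal_eq_prod_filter A.charpoly (fun z => ¬ 1 < ‖z‖)
    (fun z => by simp)
  have hmul : pu * ps = A.charpoly := by
    apply Polynomial.map_injective (algebraMap ℝ ℂ) (algebraMap ℝ ℂ).injective
    rw [Polynomial.map_mul, hpu, hps, ← Multiset.prod_add, ← Multiset.map_add,
      Multiset.filter_add_not]
    have := (IsAlgClosed.splits (A.charpoly.map (algebraMap ℝ ℂ))).eq_prod_roots
    rw [((Matrix.charpoly_monic A).map _).leadingCoeff, map_one, one_mul] at this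
    exact this.symm
  have hru : ∀ l : ℂ, (pu.map (algebraMap ℝ ℂ)).eval l = 0 → 1 < ‖l‖ := by
    intro l hl
    rw [hpu, Polynomial.eval_multiset_prod, Multiset.prod_eq_zero_iff] at hl
    simp only [Multiset.map_map, Multiset.mem_map, Multiset.mem_filter] at hl
    obtain ⟨a, ⟨-, ha⟩, hal⟩ := hl
    have : l = a := by simpa [sub_eq_zero] using hal
    rwa [this]
  have hrs : ∀ l : ℂ, (ps.map (algebraMap ℝ ℂ)).eval l = 0 → ‖l‖ ≤ 1 := by
    intro l hl
    rw [hps, Polynomial.eval_multiset_prod, Multiset.prod_eq_zero_iff] at hl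
    simp only [Multiset.map_map, Multiset.mem_map, Multiset.mem_filter] at hl
    obtain ⟨a, ⟨-, ha⟩, hal⟩ := hl
    have : l = a := by simpa [sub_eq_zero] using hal
    rw [this]
    exact not_lt.1 ha
  have hcop : IsCoprime pu ps := by
    rw [← Polynomial.isCoprime_map (algebraMap ℝ ℂ),
      Polynomial.isCoprime_iff_aeval_ne_zero_of_isAlgClosed ℂ ℂ]
    intro l
    by_contra! h
    exact absurd (hru l (by simpa [coe_aeval_eq_eval] using h.1)) (not_lt.2 (hrs l (by
      simpa [coe_aeval_eq_eval] using h.2)))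
  set Vu := LinearMap.ker (aeval f pu) with hVu
  set Vs := LinearMap.ker (aeval f ps) with hVs
  have hcompl : IsCompl Vu Vs := by
    refine ⟨Polynomial.disjoint_ker_aeval_of_isCoprime f hcop, codisjoint_iff.2 ?_⟩
    rw [hVu, hVs, Polynomial.sup_ker_aeval_eq_ker_aeval_mul_of_coprime f hcop, hmul, ← hfc,
      LinearMap.aeval_self_charpoly, LinearMap.ker_zero]
  have hinv : ∀ r : ℝ[X], ∀ x ∈ LinearMap.ker (aeval f r), f x ∈ LinearMap.ker (aeval f r) := by
    intro r x hx
    rw [LinearMap.mem_ker] at hx ⊢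
    have : aeval f r * f = f * aeval f r := by
      have := (Commute.all r X).map (aeval f)
      rw [aeval_X] at this
      exact this
    rw [← Module.End.mul_apply, this, Module.End.mul_apply, hx, map_zero]
  set fu := f.restrict (hinv pu) with hfu
  set fs := f.restrict (hinv ps) with hfs
  -- Annihilation by the factor already confines the eigenvalues of a block; its characteristic
  -- polynomial need not be identified.
  have hann : ∀ r : ℝ[X], aeval (f.restrict (hinv r)) r = 0 := by
    intro r
    have key : ∀ s : ℝ[X], ∀ x : LinearMap.ker (aeval f r),
        ((aeval (f.restrict (hinv r)) s x : LinearMap.ker (aeval f r)) : Fin d → ℝ) =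
          aeval f s x := by
      intro s
      induction s using Polynomial.induction_on' with
      | add a b ha hb => intro x; simp [ha, hb]
      | monomial n a =>
        intro x
        rw [aeval_monomial, aeval_monomial]
        have : ∀ (n : ℕ) (y : LinearMap.ker (aeval f r)),
            (((f.restrict (hinv r)) ^ n) y : Fin d → ℝ) = (f ^ n) y := by
          intro n
          induction n with
          | zero => intro y; simp
          | succ n ih => intro y; rw [pow_succ, pow_succ, Module.End.mul_apply, ih]; rfl
        simp [Algebra.algebraMap_eq_smul_one, this]
    ext x : 1
    apply Subtype.ext
    rw [key]
    exact x.2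
  let bu := Module.finBasis ℝ Vu
  let bs := Module.finBasis ℝ Vs
  have haev : ∀ {W : Submodule ℝ (Fin d → ℝ)} {k : ℕ} (b : Module.Basis (Fin k) ℝ W)
      (g : W →ₗ[ℝ] W) (r : ℝ[X]), aeval g r = 0 → aeval (LinearMap.toMatrix b b g) r = 0 := by
    intro W k b g r h
    have : LinearMap.toMatrix b b g = LinearMap.toMatrixAlgEquiv b g := rfl
    have h2 := Polynomial.aeval_algHom_apply (LinearMap.toMatrixAlgEquiv b).toAlgHom g r
    rw [h, map_zero] at h2
    exact h2
  let e := Submodule.prodEquivOfIsCompl Vu Vs hcompl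
  have hconj : ∀ x, f (e x) = e (fu x.1, fs x.2) := by
    intro x
    simp [e, hfu, hfs]
  refine ⟨_, _, LinearMap.toMatrix bu bu fu, LinearMap.toMatrix bs bs fs,
    e.symm.trans (bu.equivFun.prodCongr bs.equivFun), ?_, ?_, ?_, ?_⟩
  · intro x
    obtain ⟨y, rfl⟩ := e.surjective x
    have h1 : A.mulVec (e y) = e (fu y.1, fs y.2) := by
      rw [← hconj, hf, Matrix.toLin'_apply]
    rw [h1]
    simp only [LinearEquiv.trans_apply, LinearEquiv.symm_apply_apply, LinearEquiv.prodCongr_apply]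
    rw [Module.Basis.equivFun_apply, Module.Basis.equivFun_apply, Module.Basis.equivFun_apply,
      Module.Basis.equivFun_apply, LinearMap.toMatrix_mulVec_repr, LinearMap.toMatrix_mulVec_repr]
  · rw [LinearMap.charpoly_toMatrix, LinearMap.charpoly_toMatrix, ← LinearMap.charpoly_prodMap,
      ← hfc, ← LinearEquiv.charpoly_conj e]
    congr 1
    refine LinearMap.ext fun x => ?_
    obtain ⟨y, rfl⟩ := e.surjective x
    rw [LinearEquiv.conj_apply_apply, LinearEquiv.symm_apply_apply, hconj]
    rfl
  · intro l hl
    exact hru l (Matrix.eval_eq_zero_of_aeval_eq_zero _ pu (haev bu fu pu (hann pu)) hl)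
  · intro l hl
    exact hrs l (Matrix.eval_eq_zero_of_aeval_eq_zero _ ps (haev bs fs ps (hann ps)) hl)

/-- The sum of `max 0 (log₂ |λ|)` over the unstable eigenvalues is the logarithm of the determinant
of the unstable block. -/
lemma unstableLogSum_eq_logb_det {d p q : ℕ} (A : Matrix (Fin d) (Fin d) ℝ)
    (Au : Matrix (Fin p) (Fin p) ℝ) (As : Matrix (Fin q) (Fin q) ℝ)
    (h : A.charpoly = Au.charpoly * As.charpoly)
    (hu : ∀ l ∈ (Au.map (algebraMap ℝ ℂ)).charpoly.roots, 1 < ‖l‖)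
    (hs : ∀ l ∈ (As.map (algebraMap ℝ ℂ)).charpoly.roots, ‖l‖ ≤ 1) :
    unstableLogSum A = Real.logb 2 |Au.det| ∧ Au.det ≠ 0 := by
  classical
  have hsplit : (A.map (algebraMap ℝ ℂ)).charpoly.roots =
      (Au.map (algebraMap ℝ ℂ)).charpoly.roots + (As.map (algebraMap ℝ ℂ)).charpoly.roots := by
    rw [Matrix.charpoly_map, Matrix.charpoly_map, Matrix.charpoly_map, h, Polynomial.map_mul,
      Polynomial.roots_mul]
    exact mul_ne_zero ((Matrix.charpoly_monic Au).map _).ne_zero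
      ((Matrix.charpoly_monic As).map _).ne_zero
  have hsum : unstableLogSum A =
      ((A.map (algebraMap ℝ ℂ)).charpoly.roots.map fun l => max 0 (Real.logb 2 ‖l‖)).sum := by
    rw [unstableLogSum, Finset.sum_multiset_map_count]
    refine Finset.sum_congr rfl fun l _ => ?_
    rw [Polynomial.count_roots, nsmul_eq_mul, mul_max_of_nonneg _ _ (Nat.cast_nonneg _), mul_zero]
  have h0 : ∀ l ∈ (As.map (algebraMap ℝ ℂ)).charpoly.roots, max 0 (Real.logb 2 ‖l‖) = 0 := by
    intro l hl
    exact max_eq_left (Real.logb_nonpos (by norm_num) (norm_nonneg _) (hs l hl))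
  have h1 : ∀ l ∈ (Au.map (algebraMap ℝ ℂ)).charpoly.roots,
      max 0 (Real.logb 2 ‖l‖) = Real.logb 2 ‖l‖ := by
    intro l hl
    exact max_eq_right (Real.logb_nonneg (by norm_num) (hu l hl).le)
  have hprod : ∀ s : Multiset ℂ, (∀ l ∈ s, 1 < ‖l‖) →
      (s.map fun l => Real.logb 2 ‖l‖).sum = Real.logb 2 ‖s.prod‖ ∧ s.prod ≠ 0 := by
    intro s
    induction s using Multiset.induction_on with
    | empty => simp
    | cons a s ih =>
      intro hl
      obtain ⟨i1, i2⟩ := ih fun l hl' => hl l (Multiset.mem_cons_of_mem hl')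
      have ha : a ≠ 0 := by
        rintro rfl
        have := hl 0 (Multiset.mem_cons_self _ _)
        norm_num at this
      rw [Multiset.map_cons, Multiset.sum_cons, Multiset.prod_cons, norm_mul,
        Real.logb_mul (norm_ne_zero_iff.2 ha) (norm_ne_zero_iff.2 i2), i1]
      exact ⟨rfl, mul_ne_zero ha i2⟩
  have hdet : (Au.map (algebraMap ℝ ℂ)).charpoly.roots.prod = ((Au.det : ℝ) : ℂ) := by
    rw [← Matrix.det_eq_prod_roots_charpoly]
    exact ((algebraMap ℝ ℂ).map_det Au).symm
  obtain ⟨e1, e2⟩ := hprod _ hu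
  rw [hdet] at e1 e2
  refine ⟨?_, by exact_mod_cast e2⟩
  rw [hsum, hsplit, Multiset.map_add, Multiset.sum_add, Multiset.map_congr rfl h0,
    Multiset.map_congr rfl h1, e1]
  simp

end Spectral

/-! ### Growth of matrix powers and coverings of the unit ball -/

open Filter Topology MeasureTheory

/-- Powers of a real matrix without eigenvalues of modulus `> 1` grow subexponentially. -/
lemma Matrix.exists_norm_pow_mulVec_le {k : ℕ} (M : Matrix (Fin k) (Fin k) ℝ)
    (hM : ∀ l ∈ spectrum ℂ (M.map (algebraMap ℝ ℂ)), ‖l‖ ≤ 1) {η : ℝ} (hη : 1 < η) :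
    ∃ C : ℝ, 1 ≤ C ∧ ∀ (T : ℕ) (x : Fin k → ℝ), ‖(M ^ T).mulVec x‖ ≤ C * η ^ T * ‖x‖ := by
  let := Matrix.linftyOpNormedRing (n := Fin k) (α := ℂ)
  let := Matrix.linftyOpNormedAlgebra (R := ℂ) (n := Fin k) (α := ℂ)
  let := Matrix.linftyOpNormedAddCommGroup (m := Fin k) (n := Fin k) (α := ℝ)
  have : CompleteSpace (Matrix (Fin k) (Fin k) ℂ) := FiniteDimensional.complete ℂ _
  set a := M.map (algebraMap ℝ ℂ) with ha
  have hr : spectralRadius ℂ a < ENNReal.ofReal η := by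
    refine lt_of_le_of_lt (b := 1) (iSup₂_le fun l hl => ?_) ?_
    · have := hM l hl
      exact_mod_cast this
    · rw [← ENNReal.ofReal_one]
      exact (ENNReal.ofReal_lt_ofReal_iff (by linarith)).2 hη
  -- Gelfand's formula controls all large powers; the finitely many others go into the constant.
  have hev := (spectrum.pow_norm_pow_one_div_tendsto_nhds_spectralRadius a).eventually
    (gt_mem_nhds hr)
  obtain ⟨N, hN⟩ := eventually_atTop.1 (hev.and (eventually_ge_atTop 1))
  have hbig : ∀ n, N ≤ n → ‖a ^ n‖ ≤ η ^ n := by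
    intro n hn
    obtain ⟨h1, h2⟩ := hN n hn
    have h3 : ‖a ^ n‖ ^ (1 / n : ℝ) < η :=
      (ENNReal.ofReal_lt_ofReal_iff (by linarith)).1 h1
    have h4 : (n : ℝ) ≠ 0 := by positivity
    calc ‖a ^ n‖ = (‖a ^ n‖ ^ (1 / n : ℝ)) ^ n := by
          rw [← Real.rpow_natCast, ← Real.rpow_mul (norm_nonneg _), one_div, inv_mul_cancel₀ h4,
            Real.rpow_one]
      _ ≤ η ^ n := by gcongr
  refine ⟨1 + ∑ j ∈ Finset.range N, ‖a ^ j‖, ?_, fun T x => ?_⟩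
  · have : 0 ≤ ∑ j ∈ Finset.range N, ‖a ^ j‖ := Finset.sum_nonneg fun _ _ => norm_nonneg _
    linarith
  have hpos : 0 ≤ ∑ j ∈ Finset.range N, ‖a ^ j‖ := Finset.sum_nonneg fun _ _ => norm_nonneg _
  have h1 : ‖a ^ T‖ ≤ (1 + ∑ j ∈ Finset.range N, ‖a ^ j‖) * η ^ T := by
    have hη1 : 1 ≤ η ^ T := one_le_pow₀ hη.le
    rcases le_or_gt N T with h | h
    · nlinarith [hbig T h]
    · have := Finset.single_le_sum (f := fun j => ‖a ^ j‖) (fun _ _ => norm_nonneg _)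
        (Finset.mem_range.2 h)
      nlinarith
  have h2 : ‖M ^ T‖ = ‖a ^ T‖ := by
    have : a ^ T = (M ^ T).map (algebraMap ℝ ℂ) :=
      ((algebraMap ℝ ℂ).mapMatrix.map_pow M T).symm
    rw [this, Matrix.linfty_opNorm_def, Matrix.linfty_opNorm_def]
    simp
  calc ‖(M ^ T).mulVec x‖ ≤ ‖M ^ T‖ * ‖x‖ := Matrix.linfty_opNorm_mulVec _ _
    _ ≤ _ := by rw [h2]; gcongr

/-- The inverse of a matrix with eigenvalues of modulus `> 1` has eigenvalues of modulus `≤ 1`. -/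
lemma Matrix.norm_le_one_of_mem_spectrum_inv {k : ℕ} (M : Matrix (Fin k) (Fin k) ℝ)
    (hdet : M.det ≠ 0) (hM : ∀ l ∈ (M.map (algebraMap ℝ ℂ)).charpoly.roots, 1 < ‖l‖) :
    ∀ l ∈ spectrum ℂ (M⁻¹.map (algebraMap ℝ ℂ)), ‖l‖ ≤ 1 := by
  intro l hl
  have hu : IsUnit M.det := hdet.isUnit
  let u : (Matrix (Fin k) (Fin k) ℂ)ˣ :=
    ⟨M.map (algebraMap ℝ ℂ), M⁻¹.map (algebraMap ℝ ℂ),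
      by rw [← Matrix.map_mul, Matrix.mul_nonsing_inv _ hu]; simp,
      by rw [← Matrix.map_mul, Matrix.nonsing_inv_mul _ hu]; simp⟩
  have hl' : l ∈ spectrum ℂ (↑u⁻¹ : Matrix (Fin k) (Fin k) ℂ) := hl
  have hl0 : l ≠ 0 := spectrum.ne_zero_of_mem_of_unit hl'
  have h2 : l⁻¹ ∈ spectrum ℂ (M.map (algebraMap ℝ ℂ)) := by
    have := (spectrum.inv_mem_iff (r := Units.mk0 l hl0) (a := u⁻¹)).1 hl'
    simpa [u] using this
  have h3 := hM l⁻¹ ((Polynomial.mem_roots (Matrix.charpoly_monic _).ne_zero).2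
    (Matrix.mem_spectrum_iff_isRoot_charpoly.1 h2))
  rw [norm_inv] at h3
  exact (inv_lt_one_of_one_lt₀ h3).le.trans' (by rw [inv_inv])

open scoped Pointwise in
/-- The unit ball is covered by at most `(2 + R) ^ dim / |det L|` translates of its image under an
invertible linear map `L` of norm at most `R`. -/
lemma LinearMap.exists_finset_cover_unit_ball {E : Type*} [NormedAddCommGroup E] [NormedSpace ℝ E]
    [FiniteDimensional ℝ E] (L : E →ₗ[ℝ] E) (hL : LinearMap.det L ≠ 0) {R : ℝ} (hR : 0 ≤ R)
    (hLR : ∀ x, ‖L x‖ ≤ R * ‖x‖) :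
    ∃ F : Finset E, (F.card : ℝ) * |LinearMap.det L| ≤ (2 + R) ^ Module.finrank ℝ E ∧
      ∀ y, ‖y‖ ≤ 1 → ∃ c ∈ F, ∃ z, ‖z‖ ≤ 1 ∧ y = c + L z := by
  classical
  borelize E
  let μ : Measure E := Measure.addHaar
  set n := Module.finrank ℝ E with hn
  -- Radius `1/2`: if two translates of `W` meet, their centres differ by `L z` with `‖z‖ ≤ 1`. A
  -- maximal disjoint family therefore covers.
  set W : Set E := L '' Metric.ball 0 (1 / 2) with hW
  let Le : E ≃ₗ[ℝ] E := LinearMap.equivOfDetNeZero L hL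
  have hWo : IsOpen W := by
    have : IsOpenMap L := Le.toContinuousLinearEquiv.toHomeomorph.isOpenMap
    exact this _ Metric.isOpen_ball
  have hWb : ∀ w ∈ W, ‖w‖ ≤ R / 2 := by
    rintro w ⟨z, hz, rfl⟩
    have := hLR z
    rw [mem_ball_zero_iff] at hz
    nlinarith
  let sep : Finset E → Prop := fun F =>
    (∀ c ∈ F, ‖c‖ ≤ 1) ∧ (F : Set E).PairwiseDisjoint fun c => c +ᵥ W
  have hvpos : 0 < μ (Metric.ball 0 1) := Metric.measure_ball_pos _ _ one_pos
  have hvfin : μ (Metric.ball 0 1) ≠ ⊤ := measure_ball_lt_top.ne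
  have hμW : μ W = ENNReal.ofReal (|LinearMap.det L| * (1 / 2) ^ n) * μ (Metric.ball 0 1) := by
    rw [hW, Measure.addHaar_image_linearMap, Measure.addHaar_ball_of_pos _ _ (by norm_num),
      ← mul_assoc, ← ENNReal.ofReal_mul (abs_nonneg _)]
  have hbound : ∀ F, sep F → (F.card : ℝ) * |LinearMap.det L| ≤ (2 + R) ^ n := by
    rintro F ⟨h1, h2⟩
    have hsub : (⋃ c ∈ F, c +ᵥ W) ⊆ Metric.closedBall 0 (1 + R / 2) := by
      refine Set.iUnion₂_subset fun c hc => ?_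
      rintro _ ⟨w, hw, rfl⟩
      rw [mem_closedBall_zero_iff]
      exact (norm_add_le _ _).trans (add_le_add (h1 c hc) (hWb w hw))
    have h3 := measure_mono (μ := μ) hsub
    rw [measure_biUnion_finset h2 fun c _ => (hWo.vadd c).measurableSet] at h3
    simp only [measure_vadd, Finset.sum_const, nsmul_eq_mul] at h3
    rw [hμW, Measure.addHaar_closedBall _ _ (by positivity), ← mul_assoc,
      ENNReal.mul_le_mul_iff_left hvpos.ne' hvfin, ← ENNReal.ofReal_natCast,
      ← ENNReal.ofReal_mul (Nat.cast_nonneg _), ENNReal.ofReal_le_ofReal_iff (by positivity)] at h3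
    have h4 : (2 + R) ^ n = 2 ^ n * (1 + R / 2) ^ n := by
      rw [← mul_pow]; congr 1; ring
    have h5 : (2 : ℝ) ^ n * (1 / 2) ^ n = 1 := by rw [← mul_pow]; norm_num
    calc (F.card : ℝ) * |LinearMap.det L|
        = 2 ^ n * (F.card * (|LinearMap.det L| * (1 / 2) ^ n)) := by
          linear_combination (-(F.card : ℝ) * |LinearMap.det L|) * h5
      _ ≤ 2 ^ n * (1 + R / 2) ^ n := by gcongr
      _ = _ := h4.symm
  by_contra! hcon
  -- A separated family that does not cover can be enlarged by an uncovered point, so without a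
  -- cover there would be separated families of every size, against `hbound`.
  have hgrow : ∀ N : ℕ, ∃ F, sep F ∧ F.card = N := by
    intro N
    induction N with
    | zero => exact ⟨∅, ⟨by simp, by simp⟩, rfl⟩
    | succ N ih =>
      obtain ⟨F, hF, hFc⟩ := ih
      obtain ⟨y, hy, hyF⟩ := hcon F (hbound F hF)
      have hdisj : ∀ c ∈ F, Disjoint (y +ᵥ W) (c +ᵥ W) := by
        intro c hc
        rw [Set.disjoint_left]
        rintro _ ⟨_, ⟨z, hz, rfl⟩, rfl⟩ ⟨_, ⟨z', hz', h⟩, h'⟩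
        rw [mem_ball_zero_iff] at hz hz'
        refine hyF c hc (z' - z) ?_ ?_
        · exact (norm_sub_le _ _).trans (by linarith)
        · subst h
          simp only [vadd_eq_add] at h'
          rw [map_sub, ← add_sub_assoc, h']
          abel
      have hyn : y ∉ F := by
        intro h
        have := hdisj y h
        rw [disjoint_self, Set.bot_eq_empty, Set.vadd_set_eq_empty, hW, Set.image_eq_empty] at this
        exact Metric.nonempty_ball.2 (by norm_num) |>.ne_empty this
      refine ⟨insert y F, ⟨?_, ?_⟩, by rw [Finset.card_insert_of_notMem hyn, hFc]⟩
      · intro c hc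
        rcases Finset.mem_insert.1 hc with rfl | hc
        exacts [hy, hF.1 c hc]
      · rw [Finset.coe_insert]
        exact hF.2.insert fun c hc _ => hdisj c hc
  obtain ⟨N, hN⟩ := exists_nat_gt ((2 + R) ^ n / |LinearMap.det L|)
  obtain ⟨F, hF, hFc⟩ := hgrow N
  have h1 := hbound F hF
  rw [div_lt_iff₀ (abs_pos.2 hL), ← hFc] at hN
  linarith

/-! ### Linear trajectories and null controllability -/

/-- The state at time `k` of `x_{j+1} = A x_j + B v_j` started at `x`, with unconstrained
controls `v`. -/
def linearTransition {d m : ℕ} (A : Matrix (Fin d) (Fin d) ℝ) (B : Matrix (Fin d) (Fin m) ℝ)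
    (v : ℕ → Fin m → ℝ) : ℕ → (Fin d → ℝ) → Fin d → ℝ
  | 0, x => x
  | k + 1, x => A.mulVec (linearTransition A B v k x) + B.mulVec (v k)

section LinearTransition

variable {d m : ℕ} (A : Matrix (Fin d) (Fin d) ℝ) (B : Matrix (Fin d) (Fin m) ℝ)

lemma transition_linear_eq {U : Set (Fin m → ℝ)} (ω : ℕ → U) (k : ℕ) (x : Fin d → ℝ) :
    (ControlSystem.linear A B U).transition ω k x =
      linearTransition A B (fun j => (ω j : Fin m → ℝ)) k x := by
  induction k with
  | zero => rfl
  | succ k ih =>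
    rw [ControlSystem.transition, ih]
    rfl

/-- Superposition: it allows deviations from a reference trajectory to be steered on their own. -/
lemma linearTransition_add (v w : ℕ → Fin m → ℝ) (k : ℕ) (x y : Fin d → ℝ) :
    linearTransition A B (v + w) k (x + y) =
      linearTransition A B v k x + linearTransition A B w k y := by
  induction k with
  | zero => rfl
  | succ k ih =>
    simp only [linearTransition, ih, Pi.add_apply, Matrix.mulVec_add]
    abel

lemma linearTransition_smul (a : ℝ) (v : ℕ → Fin m → ℝ) (k : ℕ) (x : Fin d → ℝ) :
    linearTransition A B (a • v) k (a • x) = a • linearTransition A B v k x := by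
  induction k with
  | zero => rfl
  | succ k ih => simp only [linearTransition, ih, Pi.smul_apply, Matrix.mulVec_smul, smul_add]

lemma linearTransition_zero_control (k : ℕ) (x : Fin d → ℝ) :
    linearTransition A B 0 k x = (A ^ k).mulVec x := by
  induction k with
  | zero => simp [linearTransition]
  | succ k ih => simp [linearTransition, ih, pow_succ', Matrix.mulVec_mulVec]

lemma linearTransition_eq (v : ℕ → Fin m → ℝ) (k : ℕ) (x : Fin d → ℝ) :
    linearTransition A B v k x = (A ^ k).mulVec x + linearTransition A B v k 0 := by
  have := linearTransition_add A B 0 v k x 0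
  rwa [zero_add, add_zero, linearTransition_zero_control] at this

lemma linearTransition_congr {v w : ℕ → Fin m → ℝ} {k : ℕ} (h : ∀ j < k, v j = w j)
    (x : Fin d → ℝ) : linearTransition A B v k x = linearTransition A B w k x := by
  induction k with
  | zero => rfl
  | succ k ih =>
    simp only [linearTransition]
    rw [ih fun j hj => h j (by omega), h k (by omega)]

lemma linearTransition_concat (v : ℕ → Fin m → ℝ) (T k : ℕ) (x : Fin d → ℝ) :
    linearTransition A B v (T + k) x =
      linearTransition A B (fun j => v (T + j)) k (linearTransition A B v T x) := by
  induction k with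
  | zero => rfl
  | succ k ih => rw [← add_assoc, linearTransition, ih, linearTransition]

lemma continuous_linearTransition (v : ℕ → Fin m → ℝ) (k : ℕ) :
    Continuous fun x => linearTransition A B v k x := by
  rw [funext fun x => linearTransition_eq A B v k x]
  exact (continuous_const.matrix_mulVec continuous_id).add continuous_const

/-- The states which can be steered to the origin in exactly `T` steps. -/
def nullControllableSubmodule (T : ℕ) : Submodule ℝ (Fin d → ℝ) where
  carrier := {x | ∃ v, linearTransition A B v T x = 0}
  zero_mem' := ⟨0, by simp [linearTransition_zero_control]⟩
  add_mem' := by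
    rintro x y ⟨v, hv⟩ ⟨w, hw⟩
    exact ⟨v + w, by rw [linearTransition_add, hv, hw, add_zero]⟩
  smul_mem' := by
    rintro a x ⟨v, hv⟩
    exact ⟨a • v, by rw [linearTransition_smul, hv, smul_zero]⟩

/-- Zero controls hold a state at the origin once it is there. -/
lemma nullControllableSubmodule_mono : Monotone (nullControllableSubmodule A B) := by
  intro S T hST x
  rintro ⟨v, hv⟩
  obtain ⟨k, rfl⟩ := Nat.exists_eq_add_of_le hST
  refine ⟨fun j => if j < S then v j else 0, ?_⟩
  rw [linearTransition_concat, linearTransition_congr A B (w := v) (k := S) (fun j hj => by simp [hj]), hv,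
    linearTransition_congr A B (w := 0) (fun j _ => by simp), linearTransition_zero_control,
    Matrix.mulVec_zero]

variable {A B}

/-- A controllable system can be steered to the origin from every state in a common time. -/
lemma IsControllablePair.exists_nullControllable (h : IsControllablePair A B) :
    ∃ T₀, ∀ T, T₀ ≤ T → ∀ x, ∃ v, linearTransition A B v T x = 0 := by
  have hj : ∀ j : Fin d, ∃ T, (Pi.single j 1 : Fin d → ℝ) ∈ nullControllableSubmodule A B T := by
    intro j
    obtain ⟨T, ω, hω⟩ := h (Pi.single j 1) 0
    exact ⟨T, _, (transition_linear_eq A B ω T _).symm.trans hω⟩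
  choose S hS using hj
  refine ⟨Finset.univ.sup S, fun T hT x => ?_⟩
  change x ∈ nullControllableSubmodule A B T
  rw [pi_eq_sum_univ' x]
  refine Submodule.sum_mem _ fun j _ => Submodule.smul_mem _ _ ?_
  exact nullControllableSubmodule_mono A B ((Finset.le_sup (Finset.mem_univ j)).trans hT) (hS j)

lemma unstableLogSum_nonneg (A : Matrix (Fin d) (Fin d) ℝ) : 0 ≤ unstableLogSum A :=
  Finset.sum_nonneg fun _ _ => le_max_left _ _

/-! ### Few small controls keep a subsystem near the origin -/

/-- For a suitable compact neighborhood `D` of the origin, about `2 ^ (T h)` cells suffice to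
cover `D` so that `A ^ T` contracts the cells, shifted to the origin, into `D`. -/
lemma Matrix.exists_finset_cells (A : Matrix (Fin d) (Fin d) ℝ) {ε : ℝ} (hε : 0 < ε) (T₀ : ℕ) :
    ∃ D : Set (Fin d → ℝ), IsCompact D ∧ D ∈ 𝓝 0 ∧ ∃ T, T₀ ≤ T ∧ 1 ≤ T ∧
      ∃ F : Finset (Fin d → ℝ), (F.card : ℝ) ≤ 2 ^ (T * (unstableLogSum A + ε)) ∧
        ∀ y ∈ D, ∃ c ∈ F, (A ^ T).mulVec (y - c) ∈ D := by
  classical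
  obtain ⟨p, q, Au, As, P, hP, hchar, hu, hs⟩ := A.exists_unstable_stable_splitting
  obtain ⟨hsum, hdet⟩ := unstableLogSum_eq_logb_det A Au As hchar hu hs
  -- With this `η`, the growth `η ^ (T (p + q))` costs at most `2 ^ (T ε / 2)`; the other half of
  -- `ε` absorbs the constant `κ`.
  set η : ℝ := 2 ^ (ε / (2 * (p + q + 1))) with hη
  have hη1 : 1 < η := Real.one_lt_rpow (by norm_num) (by positivity)
  obtain ⟨C₁, hC₁, hu'⟩ := Au⁻¹.exists_norm_pow_mulVec_le
    (Au.norm_le_one_of_mem_spectrum_inv hdet hu) hη1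
  obtain ⟨C₂, hC₂, hs'⟩ := As.exists_norm_pow_mulVec_le (fun l hl => hs l
    ((Polynomial.mem_roots (Matrix.charpoly_monic _).ne_zero).2
      (Matrix.mem_spectrum_iff_isRoot_charpoly.1 hl))) hη1
  have hPow : ∀ (T : ℕ) x, P ((A ^ T).mulVec x) =
      ((Au ^ T).mulVec (P x).1, (As ^ T).mulVec (P x).2) := by
    intro T
    induction T with
    | zero => intro x; simp
    | succ T ih =>
      intro x
      rw [pow_succ', ← Matrix.mulVec_mulVec, hP, ih, Matrix.mulVec_mulVec, Matrix.mulVec_mulVec,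
        ← pow_succ', ← pow_succ']
  let Pc := P.toContinuousLinearEquiv
  set κ : ℝ := (3 * C₁) ^ p * (3 * C₂) ^ q with hκ
  obtain ⟨T₁, hT₁⟩ : ∃ T₁ : ℕ, ∀ T : ℕ, T₁ ≤ T → κ ≤ 2 ^ (T * (ε / 2)) := by
    have h2 : 1 < (2 : ℝ) ^ (ε / 2) := Real.one_lt_rpow (by norm_num) (by positivity)
    have := (tendsto_pow_atTop_atTop_of_one_lt h2).eventually_ge_atTop κ
    obtain ⟨T₁, hT₁⟩ := eventually_atTop.1 this
    refine ⟨T₁, fun T hT => ?_⟩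
    rw [mul_comm, Real.rpow_mul (by norm_num), Real.rpow_natCast]
    exact hT₁ T hT
  refine ⟨Pc ⁻¹' Metric.closedBall 0 1,
    Pc.toHomeomorph.isCompact_preimage.2 (isCompact_closedBall _ _),
    Pc.continuous.continuousAt.preimage_mem_nhds (by
      rw [map_zero]; exact Metric.closedBall_mem_nhds _ one_pos),
    max T₀ (max T₁ 1), le_max_left _ _, (le_max_right _ _).trans (le_max_right _ _), ?_⟩
  set T := max T₀ (max T₁ 1) with hT
  have hTκ := hT₁ T ((le_max_left _ _).trans (le_max_right _ _))
  have hηT : 1 ≤ η ^ T := one_le_pow₀ hη1.le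
  have hC₁T : 1 ≤ C₁ * η ^ T := one_le_mul_of_one_le_of_one_le hC₁ hηT
  have hC₂T : 1 ≤ C₂ * η ^ T := one_le_mul_of_one_le_of_one_le hC₂ hηT
  have hdu : LinearMap.det (Matrix.toLin' (Au⁻¹ ^ T)) = (Au.det ^ T)⁻¹ := by
    rw [LinearMap.det_toLin', Matrix.det_pow, Matrix.det_nonsing_inv, Ring.inverse_eq_inv, inv_pow]
  -- Unstable cells are images of the unit ball under `Au⁻¹ ^ T`, which `Au ^ T` undoes; there are
  -- about `|det Au| ^ T` of them.
  obtain ⟨Fu, hFu, hFu'⟩ := LinearMap.exists_finset_cover_unit_ball (Matrix.toLin' (Au⁻¹ ^ T))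
    (by rw [hdu]; exact inv_ne_zero (pow_ne_zero _ hdet)) (R := C₁ * η ^ T) (by positivity)
    (fun x => by rw [Matrix.toLin'_apply]; exact hu' T x)
  have hds : LinearMap.det ((C₂ * η ^ T)⁻¹ • (LinearMap.id : (Fin q → ℝ) →ₗ[ℝ] Fin q → ℝ)) =
      ((C₂ * η ^ T) ^ q)⁻¹ := by
    rw [LinearMap.det_smul, LinearMap.det_id, mul_one, Module.finrank_fin_fun, inv_pow]
  -- In the other block small balls suffice: `As ^ T` enlarges them at most by `C₂ * η ^ T`, and
  -- their number grows with arbitrarily small rate.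
  obtain ⟨Fs, hFs, hFs'⟩ := LinearMap.exists_finset_cover_unit_ball
    ((C₂ * η ^ T)⁻¹ • (LinearMap.id : (Fin q → ℝ) →ₗ[ℝ] Fin q → ℝ))
    (by rw [hds]; positivity) (R := 1) zero_le_one (fun x => by
      rw [LinearMap.smul_apply, LinearMap.id_apply, norm_smul, Real.norm_of_nonneg (by positivity)]
      gcongr
      exact inv_le_one_of_one_le₀ hC₂T)
  refine ⟨(Fu ×ˢ Fs).image P.symm, ?_, ?_⟩
  · rw [hdu, Module.finrank_fin_fun, abs_inv, abs_pow, ← div_eq_mul_inv,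
      div_le_iff₀ (pow_pos (abs_pos.2 hdet) _)] at hFu
    rw [hds, Module.finrank_fin_fun, abs_inv, abs_of_nonneg (by positivity), ← div_eq_mul_inv,
      div_le_iff₀ (by positivity)] at hFs
    have h1 : (2 + C₁ * η ^ T) ^ p ≤ (3 * C₁ * η ^ T) ^ p := by
      gcongr
      linarith
    have h2 : |Au.det| ^ T = 2 ^ (T * unstableLogSum A) := by
      rw [mul_comm, Real.rpow_mul (by norm_num), hsum,
        Real.rpow_logb (by norm_num) (by norm_num) (abs_pos.2 hdet), Real.rpow_natCast]
    have h3 : (η ^ T) ^ (p + q) ≤ 2 ^ (T * (ε / 2)) := by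
      rw [hη, ← pow_mul, ← Real.rpow_natCast, ← Real.rpow_mul (by norm_num)]
      apply Real.rpow_le_rpow_of_exponent_le (by norm_num)
      push_cast
      have : ε / (2 * (p + q + 1)) * (p + q) ≤ ε / 2 := by
        rw [div_mul_eq_mul_div, div_le_div_iff₀ (by positivity) (by norm_num)]
        nlinarith
      nlinarith [Nat.cast_nonneg (α := ℝ) T]
    calc (((Fu ×ˢ Fs).image P.symm).card : ℝ) ≤ ((Fu ×ˢ Fs).card : ℝ) := by
          exact_mod_cast Finset.card_image_le
      _ = Fu.card * Fs.card := by rw [Finset.card_product]; push_cast; rfl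
      _ ≤ ((3 * C₁ * η ^ T) ^ p * |Au.det| ^ T) * ((2 + 1) ^ q * (C₂ * η ^ T) ^ q) := by
          gcongr
          exact hFu.trans (by gcongr)
      _ = κ * (η ^ T) ^ (p + q) * |Au.det| ^ T := by
          rw [hκ, mul_pow _ (η ^ T), mul_pow C₂, pow_add]
          rw [mul_pow 3 C₂]
          norm_num
          ring
      _ ≤ 2 ^ (T * (ε / 2)) * 2 ^ (T * (ε / 2)) * 2 ^ (T * unstableLogSum A) := by
          rw [h2]; gcongr
      _ = _ := by
          rw [← Real.rpow_add (by norm_num), ← Real.rpow_add (by norm_num)]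
          congr 1
          ring
  · intro y hy
    rw [Set.mem_preimage, mem_closedBall_zero_iff] at hy
    change ‖P y‖ ≤ 1 at hy
    obtain ⟨cu, hcu, zu, hzu, hyu⟩ := hFu' (P y).1 ((norm_fst_le _).trans hy)
    obtain ⟨cs, hcs, zs, hzs, hys⟩ := hFs' (P y).2 ((norm_snd_le _).trans hy)
    refine ⟨P.symm (cu, cs), Finset.mem_image.2 ⟨(cu, cs), Finset.mk_mem_product hcu hcs, rfl⟩, ?_⟩
    rw [Set.mem_preimage, mem_closedBall_zero_iff]
    change ‖P _‖ ≤ 1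
    rw [hPow, map_sub, P.apply_symm_apply, Prod.fst_sub, Prod.snd_sub, hyu, hys,
      add_sub_cancel_left, add_sub_cancel_left, Prod.norm_def]
    refine max_le ?_ ?_
    · have : Au ^ T * Au⁻¹ ^ T = 1 := by
        rw [← (Commute.mul_pow ?_ T), Matrix.mul_nonsing_inv _ hdet.isUnit, one_pow]
        exact (Matrix.mul_nonsing_inv _ hdet.isUnit).trans
          (Matrix.nonsing_inv_mul _ hdet.isUnit).symm
      simp only [Matrix.toLin'_apply, Matrix.mulVec_mulVec, this, Matrix.one_mulVec, hzu]
    · simp only [LinearMap.smul_apply, LinearMap.id_apply]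
      refine (hs' T _).trans ?_
      rw [norm_smul, norm_inv, Real.norm_of_nonneg (by positivity : 0 ≤ C₂ * η ^ T), ← mul_assoc,
        mul_inv_cancel₀ (by positivity), one_mul]
      exact hzs

end LinearTransition

section LinearTransition

variable {d m : ℕ} {A : Matrix (Fin d) (Fin d) ℝ} {B : Matrix (Fin d) (Fin m) ℝ}

/-- Finitely many control words of length `T`, about `2 ^ (T h)` in number, suffice to steer a
compact neighborhood `D` of the origin back into itself, with bounded controls and states. -/
lemma IsControllablePair.exists_return_words (h : IsControllablePair A B) {ε : ℝ} (hε : 0 < ε) :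
    ∃ D : Set (Fin d → ℝ), D ∈ 𝓝 0 ∧ ∃ T : ℕ, 1 ≤ T ∧ ∃ M : ℝ, 0 ≤ M ∧
      ∃ G : Finset (ℕ → Fin m → ℝ), (G.card : ℝ) ≤ 2 ^ (T * (unstableLogSum A + ε)) ∧
        (∀ g ∈ G, ∀ k, ‖g k‖ ≤ M) ∧
        ∀ y ∈ D, ∃ g ∈ G, linearTransition A B g T y ∈ D ∧
          ∀ k ≤ T, ‖linearTransition A B g k y‖ ≤ M := by
  classical
  obtain ⟨T₀, hT₀⟩ := h.exists_nullControllable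
  obtain ⟨D, hDc, hD0, T, hT, hT1, F, hFc, hF⟩ := A.exists_finset_cells hε T₀
  choose w hw using hT₀ T hT
  let g : (Fin d → ℝ) → ℕ → Fin m → ℝ := fun c j => if j < T then w c j else 0
  have hg : ∀ c, linearTransition A B (g c) T c = 0 := fun c => by
    rw [linearTransition_congr A B (w := w c) (fun j hj => by simp [g, hj]), hw]
  have hgb : ∀ c, ∃ M : ℝ, ∀ k, ‖g c k‖ ≤ M := by
    intro c
    refine ⟨∑ j ∈ Finset.range T, ‖w c j‖, fun k => ?_⟩
    by_cases hk : k < T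
    · simp only [g, hk, if_true]
      exact Finset.single_le_sum (f := fun j => ‖w c j‖) (fun _ _ => norm_nonneg _)
        (Finset.mem_range.2 hk)
    · simp only [g, hk, if_false, norm_zero]
      exact Finset.sum_nonneg fun _ _ => norm_nonneg _
  have hsb : ∀ c k, ∃ M : ℝ, ∀ y ∈ D, ‖linearTransition A B (g c) k y‖ ≤ M := fun c k =>
    hDc.exists_bound_of_continuousOn (continuous_linearTransition A B (g c) k).continuousOn
  choose M₁ hM₁ using hgb
  choose M₂ hM₂ using hsb
  obtain ⟨M, hM⟩ := (insert 0 (F.image M₁ ∪ (F ×ˢ Finset.range (T + 1)).image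
    fun x => M₂ x.1 x.2)).exists_le
  refine ⟨D, hD0, T, hT1, M, hM 0 (Finset.mem_insert_self _ _), F.image g, ?_, ?_, ?_⟩
  · exact le_trans (by exact_mod_cast Finset.card_image_le) hFc
  · intro v hv k
    obtain ⟨c, hc, rfl⟩ := Finset.mem_image.1 hv
    exact (hM₁ c k).trans (hM _ (Finset.mem_insert_of_mem
      (Finset.mem_union_left _ (Finset.mem_image_of_mem _ hc))))
  · intro y hy
    obtain ⟨c, hc, hyc⟩ := hF y hy
    refine ⟨g c, Finset.mem_image_of_mem _ hc, ?_, fun k hk => ?_⟩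
    -- The word of `c` cancels the motion of `c`, leaving the free motion of `y - c`.
    · have h1 := linearTransition_add A B 0 (g c) T (y - c) c
      rw [zero_add, sub_add_cancel, hg, add_zero, linearTransition_zero_control] at h1
      rwa [h1]
    · exact (hM₂ c k y hy).trans (hM _ (Finset.mem_insert_of_mem (Finset.mem_union_right _
        (Finset.mem_image.2 ⟨(c, k), Finset.mk_mem_product hc (Finset.mem_range.2 (by omega)),
          rfl⟩))))

/-- A controllable linear system can be kept near the origin, over a time `t`, with about
`2 ^ (t h)` small control sequences. -/
lemma IsControllablePair.exists_small_controls (h : IsControllablePair A B) {ρ ε : ℝ}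
    (hρ : 0 < ρ) (hε : 0 < ε) :
    ∃ r : ℝ, 0 < r ∧ ∃ C : ℝ, 0 < C ∧ ∀ t : ℕ, ∃ V : Finset (ℕ → Fin m → ℝ),
      (V.card : ℝ) ≤ C * 2 ^ (t * (unstableLogSum A + ε)) ∧ (∀ v ∈ V, ∀ k, ‖v k‖ ≤ ρ) ∧
      ∀ y, ‖y‖ < r → ∃ v ∈ V, ∀ k ≤ t, ‖linearTransition A B v k y‖ < ρ := by
  classical
  obtain ⟨D, hD, T, hT, M, hM, G, hGc, hGb, hG⟩ := h.exists_return_words hε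
  obtain ⟨r, hr, hrD⟩ := Metric.mem_nhds_iff.1 hD
  -- Each word ends in `D`, so words can be concatenated; their numbers multiply.
  have hblocks : ∀ K : ℕ, ∃ V : Finset (ℕ → Fin m → ℝ),
      (V.card : ℝ) ≤ 2 ^ ((K * T : ℝ) * (unstableLogSum A + ε)) ∧ (∀ v ∈ V, ∀ k, ‖v k‖ ≤ M) ∧
      ∀ y ∈ D, ∃ v ∈ V, ∀ k ≤ K * T, ‖linearTransition A B v k y‖ ≤ M := by
    intro K
    induction K with
    | zero =>
      refine ⟨{0}, by simp, by simpa using hM, fun y hy => ⟨0, by simp, fun k hk => ?_⟩⟩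
      obtain ⟨g, -, -, hg⟩ := hG y hy
      obtain rfl : k = 0 := by simpa using hk
      exact hg 0 (Nat.zero_le _)
    | succ K ih =>
      obtain ⟨V, hVc, hVb, hV⟩ := ih
      let cat : (ℕ → Fin m → ℝ) × (ℕ → Fin m → ℝ) → ℕ → Fin m → ℝ :=
        fun x j => if j < T then x.1 j else x.2 (j - T)
      refine ⟨(G ×ˢ V).image cat, ?_, ?_, ?_⟩
      · calc (((G ×ˢ V).image cat).card : ℝ) ≤ ((G ×ˢ V).card : ℝ) := by
              exact_mod_cast Finset.card_image_le
          _ = G.card * V.card := by rw [Finset.card_product]; push_cast; rfl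
          _ ≤ 2 ^ (T * (unstableLogSum A + ε)) * 2 ^ ((K * T : ℝ) * (unstableLogSum A + ε)) := by
              gcongr
          _ = _ := by
              rw [← Real.rpow_add (by norm_num)]
              congr 1
              push_cast
              ring
      · intro v hv k
        obtain ⟨⟨g, v⟩, hgv, rfl⟩ := Finset.mem_image.1 hv
        obtain ⟨hg, hv⟩ := Finset.mem_product.1 hgv
        simp only [cat]
        split_ifs
        exacts [hGb g hg k, hVb v hv _]
      · intro y hy
        obtain ⟨g, hg, hgD, hgb⟩ := hG y hy
        obtain ⟨v, hv, hvb⟩ := hV _ hgD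
        have h1 : ∀ k ≤ T, linearTransition A B (cat (g, v)) k y =
            linearTransition A B g k y := fun k hk =>
          linearTransition_congr A B (fun j hj => by simp [cat, hj.trans_le hk]) y
        refine ⟨cat (g, v), Finset.mem_image_of_mem _ (Finset.mk_mem_product hg hv),
          fun k hk => ?_⟩
        rcases le_total k T with hkT | hkT
        · rw [h1 k hkT]
          exact hgb k hkT
        · obtain ⟨l, rfl⟩ := Nat.exists_eq_add_of_le hkT
          have h2 : (fun j => cat (g, v) (T + j)) = v := by
            funext j
            simp [cat]
          rw [linearTransition_concat, h1 T le_rfl, h2]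
          refine hvb l ?_
          rw [add_mul, one_mul] at hk
          omega
  -- By linearity, scaling by `s` brings the bound `M` on controls and states below `ρ`.
  set s : ℝ := ρ / (M + 1) with hs
  have hs0 : 0 < s := by positivity
  have hsM : s * M < ρ := by
    rw [hs, div_mul_eq_mul_div, div_lt_iff₀ (by positivity)]
    nlinarith
  have hh : 0 ≤ unstableLogSum A + ε := add_nonneg (unstableLogSum_nonneg A) hε.le
  -- Rounding `t` up to whole blocks adds at most `T` steps, which the constant pays for.
  refine ⟨s * r, by positivity, 2 ^ (T * (unstableLogSum A + ε)), by positivity, fun t => ?_⟩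
  obtain ⟨V, hVc, hVb, hV⟩ := hblocks (t / T + 1)
  refine ⟨V.image fun v => s • v, ?_, ?_, ?_⟩
  · refine le_trans (by exact_mod_cast Finset.card_image_le) (hVc.trans ?_)
    rw [← Real.rpow_add (by norm_num), ← add_mul]
    apply Real.rpow_le_rpow_of_exponent_le (by norm_num)
    refine mul_le_mul_of_nonneg_right ?_ hh
    have : (t / T + 1) * T ≤ T + t := by
      have := Nat.div_mul_le_self t T
      linarith
    exact_mod_cast this
  · intro v hv k
    obtain ⟨v, hv', rfl⟩ := Finset.mem_image.1 hv
    rw [Pi.smul_apply, norm_smul, Real.norm_of_nonneg hs0.le]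
    exact (mul_le_mul_of_nonneg_left (hVb v hv' k) hs0.le).trans hsM.le
  · intro y hy
    obtain ⟨v, hv, hvb⟩ := hV (s⁻¹ • y) (hrD (by
      rw [mem_ball_zero_iff, norm_smul, norm_inv, Real.norm_of_nonneg hs0.le,
        inv_mul_lt_iff₀ hs0]
      exact hy))
    refine ⟨s • v, Finset.mem_image_of_mem _ hv, fun k hk => ?_⟩
    have h1 := linearTransition_smul A B s v k (s⁻¹ • y)
    rw [smul_inv_smul₀ hs0.ne'] at h1
    rw [h1, norm_smul, Real.norm_of_nonneg hs0.le]
    refine (mul_le_mul_of_nonneg_left (hvb k (hk.trans ?_)) hs0.le).trans_lt hsM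
    have := Nat.lt_div_mul_add (a := t) (b := T) hT
    linarith

end LinearTransition

/-! ### Lower bound by volume growth -/

/-- Volume bound: control sequences which keep a compact set with nonempty interior invariant at
time `t` number at least `2 ^ (t h)`. -/
lemma mul_unstableLogSum_le_logb_card {d m : ℕ} (A : Matrix (Fin d) (Fin d) ℝ)
    (B : Matrix (Fin d) (Fin m) ℝ) {Q : Set (Fin d → ℝ)} (hQ : IsCompact Q)
    (hQi : (interior Q).Nonempty) {t : ℕ} (S : Finset (ℕ → Fin m → ℝ))
    (hS : ∀ x ∈ Q, ∃ v ∈ S, linearTransition A B v t x ∈ Q) :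
    t * unstableLogSum A ≤ Real.logb 2 S.card := by
  obtain ⟨p, q, Au, As, P, hP, hchar, hu, hs⟩ := A.exists_unstable_stable_splitting
  obtain ⟨hsum, hdet⟩ := unstableLogSum_eq_logb_det A Au As hchar hu hs
  have hPow : ∀ (T : ℕ) x, (P ((A ^ T).mulVec x)).1 = (Au ^ T).mulVec (P x).1 := by
    intro T
    induction T with
    | zero => intro x; simp
    | succ T ih =>
      intro x
      rw [pow_succ', ← Matrix.mulVec_mulVec, hP, ih, Matrix.mulVec_mulVec, ← pow_succ']
  have hcont : Continuous fun x => (P x).1 :=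
    continuous_fst.comp P.toContinuousLinearEquiv.continuous
  have hopen : IsOpenMap fun x => (P x).1 :=
    isOpenMap_fst.comp P.toContinuousLinearEquiv.toHomeomorph.isOpenMap
  set W : Set (Fin p → ℝ) := (fun x => (P x).1) '' Q with hW
  have hWfin : volume W ≠ ⊤ := (hQ.image hcont).measure_ne_top
  have hWpos : volume W ≠ 0 := by
    refine ((hopen _ isOpen_interior).measure_pos volume (hQi.image _)).trans_le
      (measure_mono (Set.image_mono interior_subset)) |>.ne'
  let L : (Fin p → ℝ) →ₗ[ℝ] Fin p → ℝ := Matrix.toLin' (Au ^ t)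
  have hLdet : LinearMap.det L = Au.det ^ t := by rw [LinearMap.det_toLin', Matrix.det_pow]
  have hcover : W ⊆ ⋃ v ∈ S, (fun z => L z + (P (linearTransition A B v t 0)).1) ⁻¹' W := by
    rintro _ ⟨x, hx, rfl⟩
    obtain ⟨v, hv, hvQ⟩ := hS x hx
    refine Set.mem_iUnion₂.2 ⟨v, hv, linearTransition A B v t x, hvQ, ?_⟩
    simp only [L]
    rw [linearTransition_eq, map_add, Prod.fst_add, hPow, Matrix.toLin'_apply]
  have hpiece : ∀ v ∈ S, volume ((fun z => L z + (P (linearTransition A B v t 0)).1) ⁻¹' W) =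
      ENNReal.ofReal (|Au.det| ^ t)⁻¹ * volume W := by
    intro v _
    have : (fun z => L z + (P (linearTransition A B v t 0)).1) ⁻¹' W =
        L ⁻¹' ((fun z => z + (P (linearTransition A B v t 0)).1) ⁻¹' W) := rfl
    rw [this, Measure.addHaar_preimage_linearMap _ (by rw [hLdet]; exact pow_ne_zero _ hdet),
      measure_preimage_add_right, hLdet, abs_inv, abs_pow]
  have h1 := (measure_mono (μ := volume) hcover).trans (measure_biUnion_finset_le S _)
  rw [Finset.sum_congr rfl hpiece, Finset.sum_const, nsmul_eq_mul, ← mul_assoc] at h1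
  nth_rewrite 1 [← one_mul (volume W)] at h1
  have hpow : 0 < |Au.det| ^ t := pow_pos (abs_pos.2 hdet) t
  rw [ENNReal.mul_le_mul_iff_left hWpos hWfin, ← ENNReal.ofReal_natCast,
    ← ENNReal.ofReal_mul (Nat.cast_nonneg _), ENNReal.one_le_ofReal, ← div_eq_mul_inv,
    le_div_iff₀ hpow, one_mul] at h1
  rw [hsum, ← Real.logb_pow]
  exact Real.logb_le_logb_of_le (by norm_num) hpow h1

/-! ### Passage from subsystems to the network -/

section Network

variable {ι : Type*} {X U : ι → Type*} [∀ i, TopologicalSpace (X i)]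

lemma ControlSystem.transition_network_apply (C : ∀ i, ControlSystem (X i) (U i))
    (ω : ℕ → ∀ i, U i) (k : ℕ) (x : ∀ i, X i) (i : ι) :
    (ControlSystem.network C).transition ω k x i =
      (C i).transition (fun j => ω j i) k (x i) := by
  induction k with
  | zero => rfl
  | succ k ih =>
    simp only [ControlSystem.transition, ← ih]
    rfl

end Network

section LinearNetwork

variable {ι : Type*} {d m : ι → ℕ} {A : ∀ i, Matrix (Fin (d i)) (Fin (d i)) ℝ}
  {B : ∀ i, Matrix (Fin (d i)) (Fin (m i)) ℝ} {U : ∀ i, Set (Fin (m i) → ℝ)}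
  {Q : Set (∀ i, Fin (d i) → ℝ)}

/-- Finite-time entropy vectors of a linear network are bounded below by the unstable
logarithmic sums. -/
lemma unstableLogSum_le_of_mem_finiteTimeEntropySet (hQ : IsCompact Q)
    (hQi : (interior Q).Nonempty) {t : ℕ} (ht : 1 ≤ t) {ξ : ι → ℝ}
    (hξ : ξ ∈ ControlSystem.finiteTimeEntropySet
      (fun i => ControlSystem.linear (A i) (B i) (U i)) Q t) (i : ι) :
    unstableLogSum (A i) ≤ ξ i := by
  classical
  obtain ⟨S, hS, hcard⟩ := hξ
  have ht0 : (0 : ℝ) < t := by exact_mod_cast ht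
  rw [hcard i, one_div, ← div_eq_inv_mul, le_div_iff₀ ht0, mul_comm]
  let coe : (ℕ → U i) → ℕ → Fin (m i) → ℝ := fun ω k => ω k
  have hinj : Function.Injective coe := fun ω ω' h =>
    funext fun k => Subtype.ext (congrFun h k)
  rw [← Finset.card_image_of_injective (S i) hinj]
  refine mul_unstableLogSum_le_logb_card (A i) (B i) (Q := Function.eval i '' Q)
    (hQ.image (continuous_apply i)) ?_ _ ?_
  · refine (hQi.image (Function.eval i)).mono ?_
    exact interior_maximal (Set.image_mono interior_subset)
      (isOpenMap_eval i _ isOpen_interior)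
  · rintro _ ⟨x, hx, rfl⟩
    obtain ⟨ω, hω, hωQ⟩ := hS x hx
    refine ⟨_, Finset.mem_image_of_mem _ (hω i), _, interior_subset (hωQ t ht le_rfl), ?_⟩
    rw [Function.eval, ControlSystem.transition_network_apply, transition_linear_eq]

/-- Strong invariance can be achieved with controls uniformly inside the control value sets. -/
lemma ControlSystem.StronglyInvariant.exists_interior_controls [Fintype ι]
    (hU : ∀ i, U i ⊆ closure (interior (U i))) (hQ : IsCompact Q)
    (hinv : (ControlSystem.network fun i =>
      ControlSystem.linear (A i) (B i) (U i)).StronglyInvariant Q) :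
    ∃ K : Set (∀ i, Fin (d i) → ℝ), IsCompact K ∧ K ⊆ interior Q ∧ ∃ δ : ℝ, 0 < δ ∧
      ∀ x ∈ Q, ∃ u : ∀ i, Fin (m i) → ℝ,
        (fun i => (A i).mulVec (x i) + (B i).mulVec (u i)) ∈ K ∧
          ∀ i, Metric.closedBall (u i) δ ⊆ U i := by
  obtain ⟨K, hK, hKQ, hsteer⟩ := hinv
  refine ⟨K, hK, hKQ, ?_⟩
  let f : (∀ i, Fin (d i) → ℝ) → (∀ i, Fin (m i) → ℝ) → ∀ i, Fin (d i) → ℝ :=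
    fun x u i => (A i).mulVec (x i) + (B i).mulVec (u i)
  have hfx : ∀ u, Continuous fun x => f x u := fun u => continuous_pi fun i =>
    ((continuous_const (y := A i)).matrix_mulVec (continuous_apply i)).add
      (continuous_const (y := (B i).mulVec (u i)))
  have hfu : ∀ x, Continuous fun u => f x u := fun x => continuous_pi fun i =>
    (continuous_const (y := (A i).mulVec (x i))).add
      ((continuous_const (y := B i)).matrix_mulVec (continuous_apply i))
  suffices h : ∃ δ : ℝ, 0 < δ ∧ ∀ x ∈ Q, ∃ u, f x u ∈ interior K ∧
      ∀ i, Metric.closedBall (u i) δ ⊆ U i by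
    obtain ⟨δ, hδ, h⟩ := h
    exact ⟨δ, hδ, fun x hx => let ⟨u, hu, hb⟩ := h x hx; ⟨u, interior_subset hu, hb⟩⟩
  -- A control with a ball inside `U i` that steers `x` into `int K` serves all states near `x`;
  -- compactness then yields one `δ`.
  refine hQ.induction_on (p := fun s => ∃ δ : ℝ, 0 < δ ∧ ∀ x ∈ s, ∃ u, f x u ∈ interior K ∧
      ∀ i, Metric.closedBall (u i) δ ⊆ U i) ⟨1, one_pos, by simp⟩ ?_ ?_ ?_
  · rintro s s' hss' ⟨δ, hδ, h⟩
    exact ⟨δ, hδ, fun x hx => h x (hss' hx)⟩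
  · rintro s s' ⟨δ, hδ, h⟩ ⟨δ', hδ', h'⟩
    refine ⟨min δ δ', lt_min hδ hδ', fun x hx => ?_⟩
    rcases hx with hx | hx
    · obtain ⟨u, hu, hb⟩ := h x hx
      exact ⟨u, hu, fun i =>
        (Metric.closedBall_subset_closedBall (min_le_left _ _)).trans (hb i)⟩
    · obtain ⟨u, hu, hb⟩ := h' x hx
      exact ⟨u, hu, fun i =>
        (Metric.closedBall_subset_closedBall (min_le_right _ _)).trans (hb i)⟩
  · intro x hx
    obtain ⟨u, hu⟩ := hsteer x hx
    have hucl : (fun i => (u i : Fin (m i) → ℝ)) ∈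
        closure (Set.univ.pi fun i => interior (U i)) := by
      rw [closure_pi_set]
      exact fun i _ => hU i (u i).2
    obtain ⟨w, hwK, hwU⟩ := mem_closure_iff.1 hucl _ (isOpen_interior.preimage (hfu x)) hu
    have hball : ∀ᶠ δ : ℝ in 𝓝[>] 0, ∀ i, Metric.closedBall (w i) δ ⊆ U i := by
      rw [eventually_all]
      intro i
      obtain ⟨δ, hδ, h⟩ := Metric.nhds_basis_closedBall.mem_iff.1
        (mem_interior_iff_mem_nhds.1 (hwU i (Set.mem_univ i)))
      filter_upwards [Ioo_mem_nhdsGT hδ] with δ' hδ'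
      exact (Metric.closedBall_subset_closedBall hδ'.2.le).trans h
    obtain ⟨δ, hδU, hδ⟩ := (hball.and self_mem_nhdsWithin).exists
    refine ⟨_, mem_nhdsWithin_of_mem_nhds ((isOpen_interior.preimage (hfx w)).mem_nhds hwK), δ,
      hδ, fun y hy => ⟨w, hy, hδU⟩⟩

/-- Products of about `2 ^ (t h_i)` control sequences per subsystem suffice for spanning. -/
lemma exists_isSpanning_controlProduct [Fintype ι] (hU_two : ∀ i, (U i).Nontrivial)
    (hU : ∀ i, U i ⊆ closure (interior (U i)))
    (hcontr : ∀ i, IsControllablePair (A i) (B i)) (hQ : IsCompact Q)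
    (hinv : (ControlSystem.network fun i =>
      ControlSystem.linear (A i) (B i) (U i)).StronglyInvariant Q) {ε : ℝ} (hε : 0 < ε) :
    ∃ C : ι → ℝ, ∀ t : ℕ, ∃ S : ∀ i, Finset (ℕ → U i),
      (ControlSystem.network fun i => ControlSystem.linear (A i) (B i) (U i)).IsSpanning t Q
        (ControlSystem.controlProduct S) ∧
      ∀ i, ((S i).card : ℝ) ≤ C i * 2 ^ (t * (unstableLogSum (A i) + ε)) := by
  classical
  obtain ⟨K, hK, hKQ, δ, hδ, hsteer⟩ := hinv.exists_interior_controls hU hQ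
  obtain ⟨ρ₀, hρ₀, hρ₀Q⟩ := hK.exists_thickening_subset_open isOpen_interior hKQ
  have hρ : 0 < min ρ₀ δ := lt_min hρ₀ hδ
  set ρ := min ρ₀ δ
  choose r hr C hC hV using fun i => (hcontr i).exists_small_controls hρ hε
  choose! g hgK hgU using hsteer
  -- The feedback `g` sees the whole network state, but along the trajectory from a fixed `c` it is
  -- an open-loop sequence for each subsystem.
  let nom : (∀ i, Fin (d i) → ℝ) → ℕ → ∀ i, Fin (d i) → ℝ := fun x k =>
    k.rec x fun _ y i => (A i).mulVec (y i) + (B i).mulVec (g y i)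
  have hnom_succ : ∀ x k, nom x (k + 1) =
      fun i => (A i).mulVec (nom x k i) + (B i).mulVec (g (nom x k) i) := fun _ _ => rfl
  have hnomQ : ∀ x ∈ Q, ∀ k, nom x k ∈ Q := by
    intro x hx k
    induction k with
    | zero => exact hx
    | succ k ih => exact interior_subset (hKQ (hgK _ ih))
  have hnom : ∀ x i k, nom x k i =
      linearTransition (A i) (B i) (fun j => g (nom x j) i) k (x i) := by
    intro x i k
    induction k with
    | zero => rfl
    | succ k ih => rw [linearTransition, ← ih, hnom_succ]
  obtain ⟨F, hFQ, hF⟩ := hQ.elim_nhds_subcover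
    (fun c => Set.univ.pi fun i => Metric.ball (c i) (r i)) (fun c _ =>
      (isOpen_set_pi Set.finite_univ fun i _ => Metric.isOpen_ball).mem_nhds
        fun i _ => Metric.mem_ball_self (hr i))
  refine ⟨fun i => F.card * C i, fun t => ?_⟩
  choose V hVc hVb hV using fun i => hV i t
  -- The default value is never taken for `c ∈ Q` and `v ∈ V i`, since `‖v k‖ ≤ δ`.
  let w : ∀ i, (∀ i, Fin (d i) → ℝ) × (ℕ → Fin (m i) → ℝ) → ℕ → U i := fun i cv k =>
    if h : g (nom cv.1 k) i + cv.2 k ∈ U i then ⟨_, h⟩ else ⟨_, (hU_two i).nonempty.some_mem⟩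
  have hw : ∀ i, ∀ c ∈ Q, ∀ v ∈ V i, ∀ k,
      ((w i (c, v) k : U i) : Fin (m i) → ℝ) = g (nom c k) i + v k := by
    intro i c hc v hv k
    have : g (nom c k) i + v k ∈ U i := hgU _ (hnomQ c hc k) i (by
      rw [mem_closedBall_iff_norm, add_sub_cancel_left]
      exact (hVb i v hv k).trans (min_le_right _ _))
    simp only [w, this, dif_pos]
  refine ⟨fun i => (F ×ˢ V i).image (w i), fun x hx => ?_, fun i => ?_⟩
  · obtain ⟨c, hcF, hxc⟩ := Set.mem_iUnion₂.1 (hF hx)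
    have hcQ := hFQ c hcF
    choose v hv hvt using fun i => hV i (x i - c i) (by
      have := hxc i (Set.mem_univ i)
      rwa [mem_ball_iff_norm] at this)
    -- All subsystems use the same centre `c`; the product contains this choice because every factor
    -- lists all centres.
    refine ⟨fun k i => w i (c, v i) k, fun i =>
      Finset.mem_image_of_mem _ (Finset.mk_mem_product hcF (hv i)), fun k hk1 hkt => ?_⟩
    apply hρ₀Q
    -- The nominal trajectory is in `K` only from time 1 on.
    obtain ⟨k, rfl⟩ := Nat.exists_eq_add_of_le' hk1
    refine Metric.mem_thickening_iff.2 ⟨nom c (k + 1), hgK _ (hnomQ c hcQ k), ?_⟩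
    rw [dist_pi_lt_iff hρ₀]
    intro i
    rw [ControlSystem.transition_network_apply, transition_linear_eq]
    have h1 : (fun j => ((w i (c, v i) j : U i) : Fin (m i) → ℝ)) =
        (fun j => g (nom c j) i) + v i := funext fun j => hw i c hcQ _ (hv i) j
    have h2 := linearTransition_add (A i) (B i) (fun j => g (nom c j) i) (v i) (k + 1) (c i)
      (x i - c i)
    rw [add_sub_cancel] at h2
    rw [h1, h2, ← hnom, dist_eq_norm, add_sub_cancel_left]
    exact (hvt i _ hkt).trans_le (min_le_left _ _)
  · calc (((F ×ˢ V i).image (w i)).card : ℝ) ≤ ((F ×ˢ V i).card : ℝ) := by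
          exact_mod_cast Finset.card_image_le
      _ = F.card * (V i).card := by rw [Finset.card_product]; push_cast; rfl
      _ ≤ F.card * (C i * 2 ^ (t * (unstableLogSum (A i) + ε))) := by
          gcongr
          exact hVc i
      _ = _ := (mul_assoc _ _ _).symm

end LinearNetwork

/-! ### The network entropy set -/

theorem proposition5 (n : ℕ) (d m : Fin n → ℕ)
    (A : ∀ i, Matrix (Fin (d i)) (Fin (d i)) ℝ)
    (B : ∀ i, Matrix (Fin (d i)) (Fin (m i)) ℝ)
    (U : ∀ i, Set (Fin (m i) → ℝ))
    (hU_two : ∀ i, (U i).Nontrivial)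
    (hU_reg : ∀ i, U i ⊆ closure (interior (U i)))
    (hcontr : ∀ i, IsControllablePair (A i) (B i))
    (Q : Set (∀ i, Fin (d i) → ℝ))
    (hQ_compact : IsCompact Q)
    (hQ_int : (interior Q).Nonempty)
    (hQ_inv : (ControlSystem.network fun i =>
      ControlSystem.linear (A i) (B i) (U i)).StronglyInvariant Q) :
    ControlSystem.networkEntropySet (fun i => ControlSystem.linear (A i) (B i) (U i)) Q =
      Set.univ.pi fun i => Set.Ici (unstableLogSum (A i)) := by
  apply Set.Subset.antisymm
  · intro ξ hξ
    have h1 := Set.mem_iInter₂.1 hξ 1 one_pos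
    refine closure_minimal ?_ (isClosed_set_pi fun i _ => isClosed_Ici) h1
    refine Set.iUnion₂_subset fun t ht ζ hζ i _ => ?_
    exact unstableLogSum_le_of_mem_finiteTimeEntropySet hQ_compact hQ_int ht hζ i
  · intro ξ hξ
    refine Set.mem_iInter₂.2 fun τ hτ => Metric.mem_closure_iff.2 fun ε hε => ?_
    have hξ' : ∀ i, unstableLogSum (A i) ≤ ξ i := fun i => hξ i (Set.mem_univ i)
    have hε4 : 0 < ε / 4 := by positivity
    obtain ⟨C, hC⟩ := exists_isSpanning_controlProduct hU_two hU_reg hcontr hQ_compact hQ_inv hε4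
    -- For large `t`, a factor `2 ^ (t ε / 4)` absorbs `C i` and the factor 2 lost in the ceiling
    -- below, so the total error is at most `ε / 2`.
    have hlarge : ∀ c : ℝ, ∀ᶠ t : ℕ in atTop, c ≤ 2 ^ (t * (ε / 4)) := by
      intro c
      have h2 : 1 < (2 : ℝ) ^ (ε / 4) := Real.one_lt_rpow (by norm_num) hε4
      filter_upwards [(tendsto_pow_atTop_atTop_of_one_lt h2).eventually_ge_atTop c] with t ht
      rwa [mul_comm, Real.rpow_mul (by norm_num), Real.rpow_natCast]
    obtain ⟨t, ⟨htC, ht2⟩, htτ⟩ := (((eventually_all.2 fun i => hlarge (C i)).and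
      (hlarge 2)).and (eventually_ge_atTop τ)).exists
    have ht0 : (0 : ℝ) < t := by exact_mod_cast hτ.trans_le htτ
    obtain ⟨S, hS, hSc⟩ := hC t
    -- Two control values already give infinitely many sequences, so `S i` can be padded to about `2
    -- ^ (t * ξ i)` elements; supersets still span.
    have hinf : ∀ i, Infinite (ℕ → U i) := fun i => by
      have := (hU_two i).coe_sort
      infer_instance
    choose S' hSS' hS'c using fun i => Infinite.exists_superset_card_eq (S i)
      (max (S i).card ⌈(2 : ℝ) ^ (t * ξ i)⌉₊) (le_max_left _ _)
    refine ⟨fun i => (1 / (t : ℝ)) * Real.logb 2 ((S' i).card : ℝ), Set.mem_iUnion₂.2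
      ⟨t, htτ, S', fun x hx => ?_, fun i => rfl⟩, ?_⟩
    · obtain ⟨ω, hω, h⟩ := hS x hx
      exact ⟨ω, fun i => hSS' i (hω i), h⟩
    · rw [dist_pi_lt_iff hε]
      intro i
      have hlow : (2 : ℝ) ^ (t * ξ i) ≤ (S' i).card := by
        rw [hS'c]
        exact (Nat.le_ceil _).trans (by exact_mod_cast le_max_right _ _)
      have hsplit : (2 : ℝ) ^ (t * (ξ i + ε / 2)) =
          2 ^ (t * (ε / 4)) * 2 ^ (t * (ξ i + ε / 4)) := by
        rw [← Real.rpow_add (by norm_num)]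
        congr 1
        ring
      have hup : ((S' i).card : ℝ) ≤ 2 ^ (t * (ξ i + ε / 2)) := by
        rw [hS'c, Nat.cast_max, hsplit]
        refine max_le ((hSc i).trans ?_) ?_
        · refine mul_le_mul (htC i) ?_ (by positivity) (by positivity)
          exact Real.rpow_le_rpow_of_exponent_le (by norm_num)
            (mul_le_mul_of_nonneg_left (by linarith [hξ' i]) ht0.le)
        · have h1 : 1 ≤ (2 : ℝ) ^ (t * ξ i) := Real.one_le_rpow (by norm_num)
            (mul_nonneg ht0.le ((unstableLogSum_nonneg _).trans (hξ' i)))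
          have h3 := (Nat.ceil_lt_add_one (zero_le_one.trans h1)).le
          calc (⌈(2 : ℝ) ^ (t * ξ i)⌉₊ : ℝ) ≤ 2 * 2 ^ (t * ξ i) := by linarith
            _ ≤ 2 ^ (t * (ε / 4)) * 2 ^ (t * (ξ i + ε / 4)) := by
              refine mul_le_mul ht2 ?_ (by positivity) (by positivity)
              exact Real.rpow_le_rpow_of_exponent_le (by norm_num)
                (mul_le_mul_of_nonneg_left (by linarith) ht0.le)
      have hcpos : (0 : ℝ) < (S' i).card := lt_of_lt_of_le (by positivity) hlow
      have hl1 := (Real.le_logb_iff_rpow_le (by norm_num) hcpos).2 hlow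
      have hl2 := (Real.logb_le_iff_le_rpow (by norm_num) hcpos).2 hup
      rw [Real.dist_eq, one_div, ← div_eq_inv_mul, abs_sub_lt_iff]
      have h4 := (le_div_iff₀' ht0).2 hl1
      have h5 := (div_le_iff₀' ht0).2 hl2
      constructor <;> linarith
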